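/- Let $d\ge 1$, $p>1$, $s\in(0,1)$ and $\alpha_1,\alpha_2\in\mathbb R$, put $\alpha=\alpha_1+\alpha_2$, and assume $\alpha_1p,\ \alpha_2p\in(-d,sp)$, $0\le \alpha p<sp$ and $sp-\alpha p<d$. For measurable $u:\mathbb R^d\to\mathbb R$ let $$[u]^p:=\int_{\mathbb R^d}\int_{\mathbb R^d}\frac{|u(x)-u(y)|^p}{|x-y|^{d+sp}}\,|x|^{\alpha_1p}|y|^{\alpha_2p}\,dx\,dy\in[0,\infty],$$ and let $W^{s,p,\alpha}(\mathbb R^d)$ be the closure of $C^1_c(\mathbb R^d)$ with respect to the norm $\bigl(\|u\|_{L^p(\mathbb R^d)}^p+[u]^p\bigr)^{1/p}$, i.e. the set of all $u\in L^p(\mathbb R^d)$ such that for every $\varepsilon>0$ there is $\varphi\in C_c^1(\mathbb R^d)$ with $\bigl(\|u-\varphi\|_{L^p(\mathbb R^d)}^p+[u-\varphi]^p\bigr)^{1/p}<\varepsilon$. Then there is a constant $\mathcal C_\alpha=\mathcal C_\alpha(d,p,s,\alpha_1,\alpha_2)>0$ such that for every $u\in W^{s,p,\alpha}(\mathbb R^d)$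 with $\int_{\mathbb R^d}|u(x)|^p\,dx=1$, the positive part of $|u|^p\log|u|$ is integrable and $$\int_{\mathbb R^d}|u(x)|^p\log|u(x)|\,dx\ \le\ \frac{d}{(s-\alpha)p^2}\,\log\left(\mathcal C_\alpha\int_{\mathbb R^d}\int_{\mathbb R^d}\frac{|u(x)-u(y)|^p}{|x-y|^{d+sp}}\,|x|^{\alpha_1p}|y|^{\alpha_2p}\,dx\,dy\right).$$ Here $0^p\log 0:=0$, and the integral on the left is the difference of the integrals of the positive and the negative part, which may be $-\infty$; on the right, $\log$ is extended by $\log 0=-\infty$ and $\log\infty=\infty$. -/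

import Mathlib

open MeasureTheory
open scoped ENNReal

noncomputable section

/-- The weighted Gagliardo energy (the `p`-th power of the weighted Gagliardo seminorm)
`∬ |u(x) - u(y)|^p / |x - y|^(d + s p) |x|^(α₁ p) |y|^(α₂ p) dx dy`, with values in `[0, ∞]`. -/
def gagliardoEnergy {d : ℕ} (s p α₁ α₂ : ℝ) (u : EuclideanSpace ℝ (Fin d) → ℝ) : ℝ≥0∞ :=
  ∫⁻ y, ∫⁻ x, ENNReal.ofReal
    (|u x - u y| ^ p / ‖x - y‖ ^ ((d : ℝ) + s * p) * ‖x‖ ^ (α₁ * p) * ‖y‖ ^ (α₂ * p))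

/-- The weighted Gagliardo seminorm. -/
def gagliardoSeminorm {d : ℕ} (s p α₁ α₂ : ℝ) (u : EuclideanSpace ℝ (Fin d) → ℝ) : ℝ≥0∞ :=
  gagliardoEnergy s p α₁ α₂ u ^ (1 / p)

/-- The weighted fractional Sobolev norm `(‖u‖_p ^ p + [u] ^ p) ^ (1 / p)`. -/
def weightedSobolevNorm {d : ℕ} (s p α₁ α₂ : ℝ) (u : EuclideanSpace ℝ (Fin d) → ℝ) : ℝ≥0∞ :=
  (eLpNorm u (ENNReal.ofReal p) volume ^ p + gagliardoSeminorm s p α₁ α₂ u ^ p) ^ (1 / p)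

/-- Membership in the weighted fractional Sobolev space: `u` is an `L^p` function in the closure
of the compactly supported `C¹` functions with respect to the weighted fractional Sobolev norm. -/
def MemWeightedSobolev {d : ℕ} (s p α₁ α₂ : ℝ) (u : EuclideanSpace ℝ (Fin d) → ℝ) : Prop :=
  MemLp u (ENNReal.ofReal p) volume ∧
    ∀ ε : ℝ≥0∞, 0 < ε → ∃ φ : EuclideanSpace ℝ (Fin d) → ℝ,
      ContDiff ℝ 1 φ ∧ HasCompactSupport φ ∧ weightedSobolevNorm s p α₁ α₂ (u - φ) < ε

/-- The Lebesgue integral of a real function as an extended real number, `∫ f⁺ - ∫ f⁻`.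
It is well defined as soon as `∫ f⁺ < ∞`, and it is then `-∞` if `∫ f⁻ = ∞`. -/
def extendedIntegral {d : ℕ} (f : EuclideanSpace ℝ (Fin d) → ℝ) : EReal :=
  ((∫⁻ x, ENNReal.ofReal (f x) : ℝ≥0∞) : EReal) - ((∫⁻ x, ENNReal.ofReal (-f x) : ℝ≥0∞) : EReal)

end

/-! A weak-type bound with exponent above `p` already yields the logarithmic inequality; no Sobolev
embedding is needed. Write β = αp/2 and let E bound the energy.

By AM-GM both weights may be replaced by the power β. If |u(y)| ≥ 2l, Chebyshev gives a radius r
such that a fixed proportion of the ball of radius 3r about y has |u| < l and |x| ≥ r; these pairs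
bound the integral of |y|^β over {|u| ≥ 2l}. Splitting that set at |y| = t and optimising t gives
|{|u| ≥ τ}| ≤ K E^(d/(d+β)) τ^(-ρ), where ρ = p(d+sp-β)/(d+β), and ρ > p exactly when αp < sp.

Dyadic summation turns this into ∫ |u|^p log⁺(|u|/L) ≤ D E^(d/(d+β)) L^(p-ρ). Taking L = E^κ with κ
= d/((s-α)p²) cancels the powers of E, and log|u| ≤ log L + log⁺(|u|/L) gives the bound κ log E + D.
-/

/-! ### Symmetrisation of the weight -/

theorem gagliardoEnergy_congr_ae {d : ℕ} {s p α₁ α₂ : ℝ} {u v : EuclideanSpace ℝ (Fin d) → ℝ}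
    (h : u =ᵐ[volume] v) : gagliardoEnergy s p α₁ α₂ u = gagliardoEnergy s p α₁ α₂ v := by
  unfold gagliardoEnergy
  refine lintegral_congr_ae ?_
  filter_upwards [h] with y hy
  refine lintegral_congr_ae ?_
  filter_upwards [h] with x hx
  rw [hx, hy]

/-- AM-GM. It replaces two exponents, one of which may be negative, by their mean, which is
nonnegative in the application. -/
theorem two_mul_rpow_mul_rpow_le {X Y : ℝ} (hX : 0 < X) (hY : 0 < Y) (a b : ℝ) :
    2 * (X ^ ((a + b) / 2) * Y ^ ((a + b) / 2)) ≤ X ^ a * Y ^ b + X ^ b * Y ^ a := by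
  have h := two_mul_le_add_sq (X ^ (a / 2) * Y ^ (b / 2)) (X ^ (b / 2) * Y ^ (a / 2))
  have sq (Z : ℝ) (hZ : 0 < Z) (c : ℝ) : (Z ^ (c / 2)) ^ 2 = Z ^ c := by
    rw [← Real.rpow_natCast, ← Real.rpow_mul hZ.le]; congr 1; push_cast; ring
  have e (Z : ℝ) (hZ : 0 < Z) : Z ^ ((a + b) / 2) = Z ^ (a / 2) * Z ^ (b / 2) := by
    rw [← Real.rpow_add hZ]; congr 1; ring
  rw [mul_pow, mul_pow, sq X hX, sq X hX, sq Y hY, sq Y hY] at h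
  rw [e X hX, e Y hY]
  linarith

/-- The energy dominates the energy with the two weight exponents replaced by their mean. -/
theorem lintegral_symmetrized_le_gagliardoEnergy {d : ℕ} [NeZero d] {s p α₁ α₂ : ℝ}
    {u : EuclideanSpace ℝ (Fin d) → ℝ} (hu : Measurable u) :
    ∫⁻ y, ∫⁻ x, ENNReal.ofReal (|u x - u y| ^ p / ‖x - y‖ ^ ((d : ℝ) + s * p) *
      (‖x‖ ^ ((α₁ * p + α₂ * p) / 2) * ‖y‖ ^ ((α₁ * p + α₂ * p) / 2))) ≤
      gagliardoEnergy s p α₁ α₂ u := by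
  obtain ⟨F, hF⟩ : ∃ F : EuclideanSpace ℝ (Fin d) → EuclideanSpace ℝ (Fin d) → ℝ≥0∞,
    F = fun y x => ENNReal.ofReal (|u x - u y| ^ p / ‖x - y‖ ^ ((d : ℝ) + s * p) *
      ‖x‖ ^ (α₁ * p) * ‖y‖ ^ (α₂ * p)) := ⟨_, rfl⟩
  have hFm : Measurable (Function.uncurry F) := by
    simp only [hF, Function.uncurry_def]
    have h1 : Measurable fun z : EuclideanSpace ℝ (Fin d) × EuclideanSpace ℝ (Fin d) =>
      ‖z.2 - z.1‖ := (measurable_snd.sub measurable_fst).norm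
    have h2 : Measurable fun z : EuclideanSpace ℝ (Fin d) × EuclideanSpace ℝ (Fin d) =>
      |u z.2 - u z.1| := ((hu.comp measurable_snd).sub (hu.comp measurable_fst)).abs
    exact ((((h2.pow_const _).div (h1.pow_const _)).mul (measurable_snd.norm.pow_const _)).mul
      (measurable_fst.norm.pow_const _)).ennreal_ofReal
  have hFm' : Measurable (Function.uncurry fun y x => F x y) := hFm.comp measurable_swap
  have hswap : ∫⁻ y, ∫⁻ x, F x y = ∫⁻ y, ∫⁻ x, F y x :=
    lintegral_lintegral_swap hFm'.aemeasurable
  have hE : gagliardoEnergy s p α₁ α₂ u = ∫⁻ y, ∫⁻ x, F y x := by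
    rw [hF, gagliardoEnergy]
  -- By Tonelli the energy is invariant under exchanging x and y, so AM-GM can be applied pointwise
  -- to the doubled integrand.
  have hadd : ∫⁻ y, ∫⁻ x, (F y x + F x y) = 2 * gagliardoEnergy s p α₁ α₂ u := by
    have h1 (y : EuclideanSpace ℝ (Fin d)) :
        ∫⁻ x, (F y x + F x y) = (∫⁻ x, F y x) + ∫⁻ x, F x y :=
      lintegral_add_left (hFm.comp measurable_prodMk_left) _
    simp_rw [h1]
    rw [lintegral_add_left hFm.lintegral_prod_right, hswap, hE, two_mul]
  have h0 : ∀ᵐ x : EuclideanSpace ℝ (Fin d), x ≠ 0 := by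
    rw [ae_iff]; simp
  rw [← ENNReal.mul_le_mul_iff_right (a := 2) (by simp) (by simp), ← hadd,
    ← lintegral_const_mul' _ _ (by simp)]
  refine lintegral_mono_ae ?_
  filter_upwards [h0] with y hy
  rw [← lintegral_const_mul' _ _ (by simp)]
  refine lintegral_mono_ae ?_
  filter_upwards [h0] with x hx
  have hx' := norm_pos_iff.mpr hx
  have hy' := norm_pos_iff.mpr hy
  have e2 (G : ℝ) : 2 * ENNReal.ofReal G = ENNReal.ofReal (2 * G) := by
    rw [ENNReal.ofReal_mul two_pos.le, ENNReal.ofReal_ofNat]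
  simp only [hF]
  rw [← ENNReal.ofReal_add (by positivity) (by positivity), e2, abs_sub_comm (u y), norm_sub_rev y]
  refine ENNReal.ofReal_le_ofReal ?_
  have h := mul_le_mul_of_nonneg_left (two_mul_rpow_mul_rpow_le hx' hy' (α₁ * p) (α₂ * p))
    (show 0 ≤ |u x - u y| ^ p / ‖x - y‖ ^ ((d : ℝ) + s * p) by positivity)
  linarith

/-! ### Weak-type bound for superlevel sets -/

theorem volume_ball_eq_ofReal {d : ℕ} [NeZero d] (x : EuclideanSpace ℝ (Fin d)) {r : ℝ}
    (hr : 0 ≤ r) : volume (Metric.ball x r) =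
      ENNReal.ofReal (volume.real (Metric.ball (0 : EuclideanSpace ℝ (Fin d)) 1) * r ^ d) := by
  rw [Measure.addHaar_ball _ _ hr, mul_comm, finrank_euclideanSpace_fin,
    ENNReal.ofReal_mul measureReal_nonneg, ofReal_measureReal measure_ball_lt_top.ne]

theorem volume_real_unit_ball_pos (d : ℕ) :
    0 < volume.real (Metric.ball (0 : EuclideanSpace ℝ (Fin d)) 1) :=
  ENNReal.toReal_pos (Metric.measure_ball_pos _ _ one_pos).ne' measure_ball_lt_top.ne

/-- The radius factor 3 suffices because 3^d - 1 - 1 ≥ 1 for d ≥ 1. -/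
theorem le_volume_ball_diff {d : ℕ} [NeZero d] (y : EuclideanSpace ℝ (Fin d)) {r : ℝ} (hr : 0 < r)
    {F : Set (EuclideanSpace ℝ (Fin d))} (hF : volume F ≤ ENNReal.ofReal
      (volume.real (Metric.ball (0 : EuclideanSpace ℝ (Fin d)) 1) * r ^ d)) :
    ENNReal.ofReal (volume.real (Metric.ball (0 : EuclideanSpace ℝ (Fin d)) 1) * r ^ d) ≤
      volume ((Metric.ball y (3 * r) \ Metric.ball 0 r) \ F) := by
  have hv := volume_real_unit_ball_pos d
  set v := volume.real (Metric.ball (0 : EuclideanSpace ℝ (Fin d)) 1)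
  have h : volume (Metric.ball y (3 * r)) - volume (Metric.ball (0 : EuclideanSpace ℝ (Fin d)) r)
      - volume F ≤ volume ((Metric.ball y (3 * r) \ Metric.ball 0 r) \ F) :=
    (tsub_le_tsub_right le_measure_sdiff _).trans le_measure_sdiff
  refine le_trans ?_ h
  rw [volume_ball_eq_ofReal _ (by positivity), volume_ball_eq_ofReal _ hr.le,
    ← ENNReal.ofReal_sub _ (by positivity)]
  refine le_trans ?_ (tsub_le_tsub_left hF _)
  rw [← ENNReal.ofReal_sub _ (by positivity)]
  refine ENNReal.ofReal_le_ofReal ?_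
  have h3 : (3 : ℝ) ≤ 3 ^ d := le_self_pow₀ (by norm_num) (NeZero.ne d)
  have hr' : 0 < v * r ^ d := by positivity
  rw [mul_pow]
  nlinarith

theorem lintegral_norm_rpow_superlevel_le {d : ℕ} [NeZero d] {s p α₁ α₂ : ℝ} (hp : 0 < p)
    (hs : 0 ≤ s) (hα : 0 ≤ (α₁ * p + α₂ * p) / 2) {u : EuclideanSpace ℝ (Fin d) → ℝ}
    (hu : Measurable u) {l r : ℝ} (hl : 0 < l) (hr : 0 < r)
    (hF : volume {x | l ≤ |u x|} ≤ ENNReal.ofReal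
      (volume.real (Metric.ball (0 : EuclideanSpace ℝ (Fin d)) 1) * r ^ d)) :
    ENNReal.ofReal (l ^ p / (3 * r) ^ ((d : ℝ) + s * p) * r ^ ((α₁ * p + α₂ * p) / 2) *
        (volume.real (Metric.ball (0 : EuclideanSpace ℝ (Fin d)) 1) * r ^ d)) *
      ∫⁻ y in {y | 2 * l ≤ |u y|}, ENNReal.ofReal (‖y‖ ^ ((α₁ * p + α₂ * p) / 2)) ≤
      gagliardoEnergy s p α₁ α₂ u := by
  set β := (α₁ * p + α₂ * p) / 2
  have hA : MeasurableSet {y | 2 * l ≤ |u y|} := measurableSet_le measurable_const hu.abs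
  have hL : MeasurableSet {y | l ≤ |u y|} := measurableSet_le measurable_const hu.abs
  refine le_trans ?_ (lintegral_symmetrized_le_gagliardoEnergy hu)
  refine le_trans ?_ (setLIntegral_le_lintegral {y | 2 * l ≤ |u y|} _)
  rw [← lintegral_const_mul' _ _ ENNReal.ofReal_ne_top]
  refine setLIntegral_mono' hA fun y hy => ?_
  have hy : 2 * l ≤ |u y| := hy
  -- For x in T, |u(x) - u(y)| ≥ l, |x - y| < 3r and |x| ≥ r, so the integrand is bounded below by a
  -- constant multiple of |y|^β.
  set T := (Metric.ball y (3 * r) \ Metric.ball 0 r) \ {x | l ≤ |u x|} with hT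
  have hTm : MeasurableSet T := (measurableSet_ball.diff measurableSet_ball).diff hL
  have hvT := le_volume_ball_diff y hr hF
  refine le_trans ?_ (setLIntegral_le_lintegral T _)
  calc _ = ENNReal.ofReal (l ^ p / (3 * r) ^ ((d : ℝ) + s * p) * (r ^ β * ‖y‖ ^ β)) *
        ENNReal.ofReal (volume.real (Metric.ball (0 : EuclideanSpace ℝ (Fin d)) 1) * r ^ d) := by
        rw [← ENNReal.ofReal_mul (by positivity), ← ENNReal.ofReal_mul (by positivity)]
        congr 1; ring
    _ ≤ ENNReal.ofReal (l ^ p / (3 * r) ^ ((d : ℝ) + s * p) * (r ^ β * ‖y‖ ^ β)) * volume T := by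
        gcongr
    _ = ∫⁻ x in T, ENNReal.ofReal (l ^ p / (3 * r) ^ ((d : ℝ) + s * p) * (r ^ β * ‖y‖ ^ β)) := by
        rw [setLIntegral_const]
    _ ≤ _ := by
        refine setLIntegral_mono' hTm fun x hx => ENNReal.ofReal_le_ofReal ?_
        obtain ⟨⟨h1, h2⟩, h3⟩ := hx
        rw [Metric.mem_ball, dist_eq_norm] at h1
        rw [Metric.mem_ball, dist_zero_right, not_lt] at h2
        have h3 : |u x| < l := not_le.mp h3
        have h4 : l ≤ |u x - u y| := by
          have := abs_sub_abs_le_abs_sub (u y) (u x)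
          rw [abs_sub_comm] at this
          linarith
        have hxy : 0 < ‖x - y‖ := by
          rw [norm_pos_iff, sub_ne_zero]
          rintro rfl
          linarith
        have hds : 0 ≤ (d : ℝ) + s * p := by positivity
        gcongr

/-- Outside the ball of radius t one has 1 ≤ t^(-β)|y|^β. -/
theorem volume_le_add_lintegral_norm_rpow {d : ℕ} [NeZero d] {β t : ℝ} (hβ : 0 ≤ β) (ht : 0 < t)
    (A : Set (EuclideanSpace ℝ (Fin d))) (hA : MeasurableSet A) :
    volume A ≤ ENNReal.ofReal
        (volume.real (Metric.ball (0 : EuclideanSpace ℝ (Fin d)) 1) * t ^ d) +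
      ENNReal.ofReal (t ^ (-β)) * ∫⁻ y in A, ENNReal.ofReal (‖y‖ ^ β) := by
  rw [← volume_ball_eq_ofReal 0 ht.le]
  calc volume A ≤ volume (Metric.ball (0 : EuclideanSpace ℝ (Fin d)) t ∪ A \ Metric.ball 0 t) :=
        measure_mono fun x hx => by by_cases h : x ∈ Metric.ball 0 t <;> simp_all
    _ ≤ _ := measure_union_le _ _
    _ ≤ _ := by
        gcongr
        rw [← lintegral_const_mul' _ _ ENNReal.ofReal_ne_top]
        refine le_trans ?_ (lintegral_mono_set (Set.sdiff_subset (t := Metric.ball 0 t)))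
        rw [← setLIntegral_one]
        refine setLIntegral_mono' (hA.diff measurableSet_ball) fun x hx => ?_
        have h2 : t ≤ ‖x‖ := by simpa using hx.2
        rw [← ENNReal.ofReal_mul (by positivity), ← ENNReal.ofReal_one]
        refine ENNReal.ofReal_le_ofReal ?_
        rw [Real.rpow_neg ht.le, ← div_eq_inv_mul, one_le_div (by positivity)]
        gcongr

/-- Weak-type bound for the superlevel sets of a function with finite energy. -/
theorem exists_volume_superlevel_le {d : ℕ} [NeZero d] {s p α₁ α₂ : ℝ} (hp : 0 < p)
    (hs : 0 ≤ s) (hα : 0 ≤ (α₁ * p + α₂ * p) / 2) {N : ℝ} (hN : 0 < N) :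
    ∃ K : ℝ, 0 < K ∧ ∀ u : EuclideanSpace ℝ (Fin d) → ℝ, Measurable u →
      ∫⁻ x, ENNReal.ofReal (|u x| ^ p) ≤ ENNReal.ofReal N → ∀ E : ℝ, 0 < E →
      gagliardoEnergy s p α₁ α₂ u ≤ ENNReal.ofReal E → ∀ τ : ℝ, 0 < τ →
      volume {x | τ ≤ |u x|} ≤ ENNReal.ofReal (K * E ^ (d / (d + (α₁ * p + α₂ * p) / 2)) *
        τ ^ (-(p * (d + s * p - (α₁ * p + α₂ * p) / 2) / (d + (α₁ * p + α₂ * p) / 2)))) := by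
  set β := (α₁ * p + α₂ * p) / 2 with hβ
  have hv := volume_real_unit_ball_pos d
  set v := volume.real (Metric.ball (0 : EuclideanSpace ℝ (Fin d)) 1) with hvdef
  have hd : (0 : ℝ) < d := Nat.cast_pos.mpr (NeZero.pos d)
  set M : ℝ := (N / v) ^ ((s * p - β) / d) * 3 ^ ((d : ℝ) + s * p) / v with hM
  have hMpos : 0 < M := by positivity
  set θ : ℝ := d / (d + β) with hθ
  set ρ : ℝ := p * (d + s * p - β) / (d + β) with hρ
  refine ⟨(v + 1) * (M ^ θ * 2 ^ ρ), by positivity, fun u hu hN' E hE hEu τ hτ => ?_⟩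
  set l := τ / 2 with hl
  have hlpos : 0 < l := by positivity
  -- Chosen so that v r^d equals the Chebyshev bound N l^(-p).
  set r : ℝ := (N / v * l ^ (-p)) ^ (1 / (d : ℝ)) with hr
  have hrpos : 0 < r := by positivity
  have hrd : r ^ d = N / v * l ^ (-p) := by
    rw [hr, ← Real.rpow_natCast, ← Real.rpow_mul (by positivity), one_div_mul_cancel hd.ne',
      Real.rpow_one]
  have hcheb : volume {x | l ≤ |u x|} ≤ ENNReal.ofReal (v * r ^ d) := by
    have h1 : {x | l ≤ |u x|} ⊆ {x | ENNReal.ofReal (l ^ p) ≤ ENNReal.ofReal (|u x| ^ p)} := by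
      intro x hx
      have hx : l ≤ |u x| := hx
      exact ENNReal.ofReal_le_ofReal (by gcongr)
    refine (measure_mono h1).trans ((meas_ge_le_lintegral_div (by fun_prop)
      (by simpa using by positivity) ENNReal.ofReal_ne_top).trans ?_)
    refine (ENNReal.div_le_div_right hN' _).trans ?_
    rw [← ENNReal.ofReal_div_of_pos (by positivity), hrd, Real.rpow_neg hlpos.le]
    apply le_of_eq; congr 1; field_simp
  have hA : MeasurableSet {y | τ ≤ |u y|} := measurableSet_le measurable_const hu.abs
  have hmain := (lintegral_norm_rpow_superlevel_le hp hs hα hu hlpos hrpos hcheb).trans hEu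
  rw [show 2 * l = τ by rw [hl]; ring, ← hβ, ← hvdef] at hmain
  set c := l ^ p / (3 * r) ^ ((d : ℝ) + s * p) * r ^ β * (v * r ^ d) with hc
  have hcpos : 0 < c := by positivity
  set J := E / c with hJ
  have hJpos : 0 < J := by positivity
  have hint : ∫⁻ y in {y | τ ≤ |u y|}, ENNReal.ofReal (‖y‖ ^ β) ≤ ENNReal.ofReal J := by
    rw [hJ, ENNReal.ofReal_div_of_pos hcpos, ENNReal.le_div_iff_mul_le
      (Or.inl (by simpa using hcpos)) (Or.inl ENNReal.ofReal_ne_top), mul_comm]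
    exact hmain
  have hJM : J = E * (M * l ^ (-(p * (d + s * p - β) / d))) := by
    have e1 : r ^ (s * p - β) = (N / v) ^ ((s * p - β) / d) * l ^ (-(p * (s * p - β) / d)) := by
      rw [hr, ← Real.rpow_mul (by positivity), Real.mul_rpow (by positivity) (by positivity),
        ← Real.rpow_mul hlpos.le]
      congr 2 <;> ring
    have e2 : l ^ (-(p * (d + s * p - β) / d)) = l ^ (-(p * (s * p - β) / d)) / l ^ p := by
      rw [← Real.rpow_sub hlpos]; congr 1; field_simp; ring
    have e3 : c * r ^ (s * p - β) = l ^ p * v / 3 ^ ((d : ℝ) + s * p) := by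
      rw [hc, Real.mul_rpow (by norm_num) hrpos.le, Real.rpow_add hrpos, Real.rpow_sub hrpos,
        Real.rpow_natCast]
      field_simp
    have e4 : c⁻¹ = r ^ (s * p - β) * 3 ^ ((d : ℝ) + s * p) / (l ^ p * v) := by
      have : 0 < r ^ (s * p - β) := by positivity
      rw [inv_eq_one_div, div_eq_div_iff hcpos.ne' (by positivity), one_mul]
      calc l ^ p * v = l ^ p * v / 3 ^ ((d : ℝ) + s * p) * 3 ^ ((d : ℝ) + s * p) := by
            field_simp
        _ = _ := by rw [← e3]; ring
    rw [hJ, div_eq_mul_inv, e4, e1, e2, hM]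
    field_simp
  -- Balances the two terms: t^d = t^(-β) J.
  set t := J ^ (1 / (d + β)) with ht
  have htpos : 0 < t := by positivity
  have ht1 : t ^ d = J ^ θ := by
    rw [ht, ← Real.rpow_natCast, ← Real.rpow_mul hJpos.le, hθ]
    congr 1; ring
  have ht2 : t ^ (-β) * J = J ^ θ := by
    rw [ht, ← Real.rpow_mul hJpos.le]
    nth_rw 2 [← Real.rpow_one J]
    rw [← Real.rpow_add hJpos, hθ]
    congr 1; field_simp; ring
  refine (volume_le_add_lintegral_norm_rpow hα htpos _ hA).trans ?_
  refine (add_le_add_right (mul_le_mul_right hint _) _).trans (le_of_eq ?_)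
  rw [← ENNReal.ofReal_mul (by positivity), ← ENNReal.ofReal_add (by positivity) (by positivity),
    ht1, ht2, hJM]
  congr 1
  rw [Real.mul_rpow hE.le (by positivity), Real.mul_rpow hMpos.le (by positivity),
    ← Real.rpow_mul hlpos.le, show -(p * (d + s * p - β) / d) * θ = -ρ by
      rw [hθ, hρ]; field_simp, hl, Real.div_rpow hτ.le two_pos.le, Real.rpow_neg two_pos.le]
  field_simp
  rw [hvdef]

/-! ### From the weak-type bound to logarithmic integrals -/

/-- The single term with 2^k ≤ t/L < 2^(k+1) already dominates, since log 2 < 1. -/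
theorem rpow_mul_posLog_div_le_tsum {p t L : ℝ} (hp : 0 < p) (hL : 0 < L) (ht : 0 ≤ t) :
    ENNReal.ofReal (t ^ p * Real.posLog (t / L)) ≤
      ∑' k : ℕ, Set.indicator {x : ℝ | 2 ^ k * L ≤ x}
        (fun _ => ENNReal.ofReal ((2 ^ (k + 1) * L) ^ p * (k + 1))) t := by
  rcases lt_or_ge t L with h | h
  · rw [(Real.posLog_eq_zero_iff _).2, mul_zero, ENNReal.ofReal_zero]
    · exact bot_le
    · rw [abs_of_nonneg (by positivity), div_le_one hL]; exact h.le
  · have ht0 : 0 < t := hL.trans_le h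
    obtain ⟨k, hk1, hk2⟩ := exists_nat_pow_near (x := t / L) (y := 2)
      ((one_le_div hL).2 h) one_lt_two
    refine le_trans ?_ (ENNReal.le_tsum k)
    rw [le_div_iff₀ hL] at hk1
    rw [Set.indicator_of_mem (show t ∈ {x : ℝ | 2 ^ k * L ≤ x} from hk1)]
    refine ENNReal.ofReal_le_ofReal ?_
    have hlog : Real.posLog (t / L) ≤ k + 1 := by
      rw [Real.posLog_eq_log (by rw [abs_of_nonneg (by positivity)]; exact (one_le_div hL).2 h)]
      have h1 := Real.log_le_log (by positivity) hk2.le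
      rw [Real.log_pow] at h1
      push_cast at h1
      have := Real.log_two_lt_d9
      nlinarith
    have ht2 : t ≤ 2 ^ (k + 1) * L := by rw [div_lt_iff₀ hL] at hk2; exact hk2.le
    gcongr
    exact Real.posLog_nonneg

/-- A weak-type bound with exponent `ρ > p` controls `∫ |u|^p log⁺ (|u| / L)`. -/
theorem exists_lintegral_rpow_mul_posLog_le {X : Type*} [MeasurableSpace X] (μ : Measure X)
    {p ρ : ℝ} (hp : 0 < p) (hρ : p < ρ) :
    ∃ S : ℝ, 0 < S ∧ ∀ u : X → ℝ, Measurable u → ∀ K : ℝ, 0 ≤ K →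
      (∀ τ : ℝ, 0 < τ → μ {x | τ ≤ |u x|} ≤ ENNReal.ofReal (K * τ ^ (-ρ))) →
      ∀ L : ℝ, 0 < L → ∫⁻ x, ENNReal.ofReal (|u x| ^ p * Real.posLog (|u x| / L)) ∂μ ≤
        ENNReal.ofReal (S * K * L ^ (p - ρ)) := by
  -- The dyadic sum is comparable to Σ (k+1) q^k, which converges because ρ > p.
  set q : ℝ := 2 ^ (p - ρ) with hq
  have hq0 : 0 < q := by positivity
  have hq1 : q < 1 := Real.rpow_lt_one_of_one_lt_of_neg one_lt_two (by linarith)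
  have hsum : Summable fun k : ℕ => ((k : ℝ) + 1) * q ^ k := by
    have h1 := summable_pow_mul_geometric_of_norm_lt_one 1
      (r := q) (by rwa [Real.norm_of_nonneg hq0.le])
    have h2 := summable_geometric_of_lt_one hq0.le hq1
    refine (h1.add h2).congr fun k => ?_
    ring
  have hpos : 0 < ∑' k : ℕ, ((k : ℝ) + 1) * q ^ k :=
    hsum.tsum_pos (fun k => by positivity) 0 (by simp)
  refine ⟨2 ^ p * ∑' k : ℕ, ((k : ℝ) + 1) * q ^ k, by positivity, fun u hu K hK hw L hL => ?_⟩
  have hm (k : ℕ) : MeasurableSet {x : X | 2 ^ k * L ≤ |u x|} :=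
    measurableSet_le measurable_const hu.abs
  calc ∫⁻ x, ENNReal.ofReal (|u x| ^ p * Real.posLog (|u x| / L)) ∂μ
      ≤ ∫⁻ x, ∑' k : ℕ, Set.indicator {x : X | 2 ^ k * L ≤ |u x|}
        (fun _ => ENNReal.ofReal ((2 ^ (k + 1) * L) ^ p * (k + 1))) x ∂μ :=
        lintegral_mono fun x => rpow_mul_posLog_div_le_tsum hp hL (abs_nonneg (u x))
    _ = ∑' k : ℕ, ENNReal.ofReal ((2 ^ (k + 1) * L) ^ p * (k + 1)) *
          μ {x : X | 2 ^ k * L ≤ |u x|} := by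
        rw [lintegral_tsum fun k => (measurable_const.indicator (hm k)).aemeasurable]
        exact tsum_congr fun k => lintegral_indicator_const (hm k) _
    _ ≤ ∑' k : ℕ, ENNReal.ofReal (2 ^ p * K * L ^ (p - ρ) * (((k : ℝ) + 1) * q ^ k)) := by
        refine ENNReal.tsum_le_tsum fun k => ?_
        refine (mul_le_mul_right (hw _ (by positivity)) _).trans (le_of_eq ?_)
        rw [← ENNReal.ofReal_mul (by positivity)]
        congr 1
        have e1 : q ^ k = (2 ^ k : ℝ) ^ p / (2 ^ k : ℝ) ^ ρ := by
          rw [← Real.rpow_sub (by positivity), hq, ← Real.rpow_natCast, ← Real.rpow_natCast,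
            ← Real.rpow_mul two_pos.le, ← Real.rpow_mul two_pos.le, mul_comm]
        rw [e1, Real.rpow_sub hL, pow_succ', Real.mul_rpow (by positivity) hL.le,
          Real.mul_rpow (by positivity) (by positivity), Real.mul_rpow (by positivity) hL.le,
          Real.rpow_neg hL.le, Real.rpow_neg (by positivity)]
        field_simp
    _ = _ := by
        rw [← ENNReal.ofReal_tsum_of_nonneg (fun k => by positivity) (hsum.mul_left _),
          tsum_mul_left]
        congr 1; ring

theorem extendedIntegral_le_of_posLog {d : ℕ} {p : ℝ} {u : EuclideanSpace ℝ (Fin d) → ℝ}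
    (hu : AEMeasurable u) (hint : Integrable fun x => |u x| ^ p) (h1 : ∫ x, |u x| ^ p = 1)
    (hfin : ∫⁻ x, ENNReal.ofReal (|u x| ^ p * Real.log |u x|) < ⊤) {L D : ℝ} (hL : 0 < L)
    (hD : 0 ≤ D)
    (h : ∫⁻ x, ENNReal.ofReal (|u x| ^ p * Real.posLog (|u x| / L)) ≤ ENNReal.ofReal D)
    (hp : 0 < p) :
    extendedIntegral (fun x => |u x| ^ p * Real.log |u x|) ≤ ((Real.log L + D : ℝ) : EReal) := by
  have hm : AEMeasurable fun x => |u x| ^ p * Real.log |u x| := by fun_prop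
  unfold extendedIntegral
  -- If the negative part diverges, the left side is -∞; otherwise everything is integrable and real
  -- integrals can be compared.
  by_cases hneg : ∫⁻ x, ENNReal.ofReal (-(|u x| ^ p * Real.log |u x|)) = ⊤
  · rw [hneg, EReal.coe_ennreal_top, EReal.sub_top]
    exact bot_le
  · have hf : Integrable fun x => |u x| ^ p * Real.log |u x| := by
      refine ⟨hm.aestronglyMeasurable, ?_⟩
      rw [hasFiniteIntegral_iff_norm]
      refine lt_of_le_of_lt (lintegral_mono (g := fun x =>
        ENNReal.ofReal (|u x| ^ p * Real.log |u x|) +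
          ENNReal.ofReal (-(|u x| ^ p * Real.log |u x|))) fun x => ?_) ?_
      · dsimp only
        rw [Real.norm_eq_abs]
        rcases abs_choice (|u x| ^ p * Real.log |u x|) with h | h <;> rw [h]
        · exact le_self_add
        · exact le_add_self
      · rw [lintegral_add_left' hm.ennreal_ofReal]
        exact ENNReal.add_lt_top.2 ⟨hfin, lt_top_iff_ne_top.2 hneg⟩
    have hg : Integrable fun x => |u x| ^ p * Real.posLog (|u x| / L) := by
      have hgm : AEMeasurable fun x => |u x| ^ p * Real.posLog (|u x| / L) := by
        have : Measurable Real.posLog := by unfold Real.posLog; fun_prop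
        exact (by fun_prop : AEMeasurable fun x => |u x| ^ p).mul
          (this.comp_aemeasurable (by fun_prop : AEMeasurable fun x => |u x| / L))
      refine ⟨hgm.aestronglyMeasurable, ?_⟩
      rw [hasFiniteIntegral_iff_ofReal (Filter.Eventually.of_forall fun x =>
        mul_nonneg (by positivity) Real.posLog_nonneg)]
      exact h.trans_lt ENNReal.ofReal_lt_top
    have hgD : ∫ x, |u x| ^ p * Real.posLog (|u x| / L) ≤ D := by
      rw [integral_eq_lintegral_of_nonneg_ae (Filter.Eventually.of_forall fun x =>
        mul_nonneg (by positivity) Real.posLog_nonneg) hg.aestronglyMeasurable]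
      exact ENNReal.toReal_le_of_le_ofReal hD h
    have hle : ∫ x, |u x| ^ p * Real.log |u x| ≤ Real.log L + D := by
      calc ∫ x, |u x| ^ p * Real.log |u x|
          ≤ ∫ x, (|u x| ^ p * Real.log L + |u x| ^ p * Real.posLog (|u x| / L)) := by
            refine integral_mono hf ((hint.mul_const _).add hg) fun x => ?_
            dsimp only
            rw [← mul_add]
            rcases (abs_nonneg (u x)).eq_or_lt with h0 | h0
            · rw [← h0, Real.zero_rpow hp.ne']; simp
            · refine mul_le_mul_of_nonneg_left ?_ (by positivity)
              have : Real.log (|u x| / L) ≤ Real.posLog (|u x| / L) := le_max_right _ _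
              rw [Real.log_div h0.ne' hL.ne'] at this
              linarith
        _ = Real.log L + ∫ x, |u x| ^ p * Real.posLog (|u x| / L) := by
            rw [integral_add (hint.mul_const _) hg, integral_mul_const, h1, one_mul]
        _ ≤ _ := by linarith
    have hsub := integral_eq_lintegral_pos_part_sub_lintegral_neg_part hf
    rw [← EReal.coe_ennreal_toReal hfin.ne, ← EReal.coe_ennreal_toReal hneg, ← EReal.coe_sub,
      ← hsub]
    exact_mod_cast hle

theorem lintegral_abs_rpow_eq_eLpNorm_rpow {X : Type*} [MeasurableSpace X] {μ : Measure X}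
    {p : ℝ} (hp : 0 < p) (u : X → ℝ) :
    ∫⁻ x, ENNReal.ofReal (|u x| ^ p) ∂μ = eLpNorm u (ENNReal.ofReal p) μ ^ p := by
  rw [eLpNorm_eq_lintegral_rpow_enorm_toReal (by simpa using hp) ENNReal.ofReal_ne_top,
    ENNReal.toReal_ofReal hp.le, ← ENNReal.rpow_mul, one_div_mul_cancel hp.ne', ENNReal.rpow_one]
  refine lintegral_congr fun x => ?_
  rw [← ENNReal.ofReal_rpow_of_nonneg (abs_nonneg _) hp.le, ← Real.norm_eq_abs, ofReal_norm]

/-- Finite energy controls `∫ |u|^p log⁺ (|u| / L)`, with explicit dependence on energy and `L`. -/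
theorem exists_lintegral_posLog_le_energy {d : ℕ} [NeZero d] {s p α₁ α₂ : ℝ} (hp : 0 < p)
    (hs : 0 ≤ s) (hα : 0 ≤ (α₁ * p + α₂ * p) / 2) (hαs : α₁ * p + α₂ * p < s * p) {N : ℝ}
    (hN : 0 < N) :
    ∃ D : ℝ, 0 < D ∧ ∀ u : EuclideanSpace ℝ (Fin d) → ℝ, AEMeasurable u →
      ∫⁻ x, ENNReal.ofReal (|u x| ^ p) ≤ ENNReal.ofReal N → ∀ E : ℝ, 0 < E →
      gagliardoEnergy s p α₁ α₂ u ≤ ENNReal.ofReal E → ∀ L : ℝ, 0 < L →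
      ∫⁻ x, ENNReal.ofReal (|u x| ^ p * Real.posLog (|u x| / L)) ≤
        ENNReal.ofReal (D * E ^ (d / (d + (α₁ * p + α₂ * p) / 2)) *
          L ^ (p - p * (d + s * p - (α₁ * p + α₂ * p) / 2) / (d + (α₁ * p + α₂ * p) / 2))) := by
  have hd : (0 : ℝ) < d := Nat.cast_pos.mpr (NeZero.pos d)
  obtain ⟨K, hK, hw⟩ := exists_volume_superlevel_le (d := d) hp hs hα hN
  have hρ : p < p * (d + s * p - (α₁ * p + α₂ * p) / 2) / (d + (α₁ * p + α₂ * p) / 2) := by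
    rw [lt_div_iff₀ (by positivity)]
    exact mul_lt_mul_of_pos_left (by linarith) hp
  obtain ⟨S, hS, h⟩ := exists_lintegral_rpow_mul_posLog_le
    (volume : Measure (EuclideanSpace ℝ (Fin d))) hp hρ
  refine ⟨S * K, by positivity, fun u hu hN' E hE hEu L hL => ?_⟩
  -- The weak-type bound is for measurable functions, so a measurable representative is used.
  have huv := hu.ae_eq_mk
  rw [lintegral_congr_ae (huv.mono fun x hx => by rw [hx])] at hN'
  rw [gagliardoEnergy_congr_ae huv] at hEu
  rw [lintegral_congr_ae (huv.mono fun x hx => by rw [hx]), mul_assoc S K]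
  exact h _ hu.measurable_mk _ (by positivity) (fun τ hτ => hw _ hu.measurable_mk hN' E hE hEu τ hτ)
    L hL

/-! ### Integrability of the positive part -/

theorem gagliardoEnergy_lt_top_of_weightedSobolevNorm_lt {d : ℕ} {s p α₁ α₂ : ℝ} (hp : 0 < p)
    {u : EuclideanSpace ℝ (Fin d) → ℝ} (h : weightedSobolevNorm s p α₁ α₂ u < ⊤) :
    gagliardoEnergy s p α₁ α₂ u < ⊤ := by
  have h1 := (ENNReal.rpow_lt_top_iff_of_pos (one_div_pos.mpr hp)).1 h
  have h2 := (ENNReal.add_lt_top.1 h1).2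
  rwa [gagliardoSeminorm, ← ENNReal.rpow_mul, one_div_mul_cancel hp.ne', ENNReal.rpow_one] at h2

/-- If a > 2M then a ≤ 2b; otherwise log a ≤ log(2M). Used with a = |u|, b = |u - φ| and M a bound
for φ. -/
theorem rpow_mul_log_le_add {p M a b : ℝ} (hp : 0 < p) (hM : 1 ≤ M) (ha : 0 ≤ a) (hb : 0 ≤ b)
    (hab : a ≤ b + M) : a ^ p * Real.log a ≤
      2 ^ p * (b ^ p * Real.posLog (b / (1 / 2))) + a ^ p * Real.log (2 * M) := by
  rcases ha.eq_or_lt with rfl | ha'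
  · rw [Real.zero_rpow hp.ne']
    have := Real.posLog_nonneg (x := b / (1 / 2))
    simp only [zero_mul, add_zero]
    positivity
  have hlog : 0 ≤ Real.log (2 * M) := Real.log_nonneg (by linarith)
  rcases le_or_gt a (2 * M) with h | h
  · refine le_add_of_nonneg_of_le ?_ ?_
    · have := Real.posLog_nonneg (x := b / (1 / 2))
      positivity
    · gcongr
  · refine le_add_of_le_of_nonneg ?_ (by positivity)
    have hab2 : a ≤ b / (1 / 2) := by linarith
    have h2 : a ^ p ≤ 2 ^ p * b ^ p := by
      rw [← Real.mul_rpow two_pos.le hb]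
      exact Real.rpow_le_rpow ha (by linarith) hp.le
    have h3 : Real.log a ≤ Real.posLog (b / (1 / 2)) :=
      (Real.log_le_log ha' hab2).trans (le_max_right _ _)
    rw [← mul_assoc]
    exact mul_le_mul h2 h3 (Real.log_nonneg (by linarith)) (by positivity)

theorem MemWeightedSobolev.lintegral_ofReal_rpow_mul_log_lt_top {d : ℕ} [NeZero d]
    {s p α₁ α₂ : ℝ} (hp : 0 < p)
    (hs : 0 ≤ s) (hα : 0 ≤ (α₁ * p + α₂ * p) / 2) (hαs : α₁ * p + α₂ * p < s * p)
    {u : EuclideanSpace ℝ (Fin d) → ℝ} (hu : MemWeightedSobolev s p α₁ α₂ u) :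
    ∫⁻ x, ENNReal.ofReal (|u x| ^ p * Real.log |u x|) < ⊤ := by
  obtain ⟨hLp, happ⟩ := hu
  -- One approximant at finite distance is enough: only u - φ needs finite energy, and φ enters
  -- through its boundedness and membership in L^p.
  obtain ⟨φ, hφ, hφc, hnorm⟩ := happ 1 one_pos
  have hE := gagliardoEnergy_lt_top_of_weightedSobolevNorm_lt hp (hnorm.trans ENNReal.one_lt_top)
  obtain ⟨M, hM⟩ := hφc.exists_bound_of_continuous hφ.continuous
  have hφLp : MemLp φ (ENNReal.ofReal p) volume := hφ.continuous.memLp_of_hasCompactSupport hφc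
  have hvLp := hLp.sub hφLp
  have fin {w : EuclideanSpace ℝ (Fin d) → ℝ} (hw : MemLp w (ENNReal.ofReal p) volume) :
      ∫⁻ x, ENNReal.ofReal (|w x| ^ p) < ⊤ := by
    rw [lintegral_abs_rpow_eq_eLpNorm_rpow hp]
    exact ENNReal.rpow_lt_top_of_nonneg hp.le hw.2.ne
  have le_ofReal {a : ℝ≥0∞} (ha : a < ⊤) : a ≤ ENNReal.ofReal (a.toReal + 1) := by
    rw [ENNReal.le_ofReal_iff_toReal_le ha.ne (by positivity)]
    linarith
  obtain ⟨D, -, hD⟩ := exists_lintegral_posLog_le_energy (d := d) hp hs hα hαs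
    (N := (∫⁻ x, ENNReal.ofReal (|(u - φ) x| ^ p)).toReal + 1) (by positivity)
  have hpos := (hD (u - φ) hvLp.1.aemeasurable (le_ofReal (fin hvLp)) _ (by positivity)
    (le_ofReal hE) (1 / 2) (by norm_num)).trans_lt ENNReal.ofReal_lt_top
  set M' := max M 1
  have hu' : AEMeasurable u := hLp.1.aemeasurable
  calc ∫⁻ x, ENNReal.ofReal (|u x| ^ p * Real.log |u x|)
      ≤ ∫⁻ x, (ENNReal.ofReal (2 ^ p) *
          ENNReal.ofReal (|(u - φ) x| ^ p * Real.posLog (|(u - φ) x| / (1 / 2))) +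
          ENNReal.ofReal (|u x| ^ p) * ENNReal.ofReal (Real.log (2 * M'))) := by
        refine lintegral_mono fun x => ?_
        rw [← ENNReal.ofReal_mul (by positivity), ← ENNReal.ofReal_mul (by positivity)]
        refine (ENNReal.ofReal_le_ofReal (rpow_mul_log_le_add hp (le_max_right M 1)
          (abs_nonneg _) (abs_nonneg ((u - φ) x)) ?_)).trans ENNReal.ofReal_add_le
        have h1 := abs_sub_abs_le_abs_sub (u x) (φ x)
        have h2 : |φ x| ≤ M' := (hM x).trans (le_max_left _ _)
        rw [Pi.sub_apply]
        linarith
    _ = ENNReal.ofReal (2 ^ p) *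
          (∫⁻ x, ENNReal.ofReal (|(u - φ) x| ^ p * Real.posLog (|(u - φ) x| / (1 / 2)))) +
          (∫⁻ x, ENNReal.ofReal (|u x| ^ p)) * ENNReal.ofReal (Real.log (2 * M')) := by
        rw [lintegral_add_right' _ (by fun_prop), lintegral_const_mul' _ _ ENNReal.ofReal_ne_top,
          lintegral_mul_const' _ _ ENNReal.ofReal_ne_top]
    _ < ⊤ := ENNReal.add_lt_top.2 ⟨ENNReal.mul_lt_top ENNReal.ofReal_lt_top hpos,
        ENNReal.mul_lt_top (fin hLp) ENNReal.ofReal_lt_top⟩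

/-! ### Choice of the level L and conclusion -/

/-- Allows working with positive real E only; for zero energy, letting E tend to 0 forces the value
-∞. -/
theorem le_mul_log_of_forall_le {a : EReal} {κ C : ℝ} (hκ : 0 < κ) (hC : 0 < C) {e : ℝ≥0∞}
    (h : ∀ E : ℝ, 0 < E → e ≤ ENNReal.ofReal E → a ≤ ((κ * Real.log (C * E) : ℝ) : EReal)) :
    a ≤ (κ : EReal) * ENNReal.log (ENNReal.ofReal C * e) := by
  rcases eq_or_ne e ⊤ with rfl | he
  · rw [ENNReal.mul_top (by simpa using hC), ENNReal.log_top, EReal.coe_mul_top_of_pos hκ]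
    exact le_top
  rcases eq_or_ne e 0 with rfl | he0
  · rw [mul_zero, ENNReal.log_zero, EReal.coe_mul_bot_of_pos hκ, le_bot_iff, EReal.eq_bot_iff_forall_lt]
    intro y
    refine lt_of_le_of_lt (h (Real.exp ((y - 1) / κ) / C) (by positivity) bot_le) ?_
    rw [mul_div_cancel₀ _ hC.ne', Real.log_exp, mul_div_cancel₀ _ hκ.ne']
    exact_mod_cast sub_one_lt y
  · have hpos := ENNReal.toReal_pos he0 he
    have h1 := h e.toReal hpos (ENNReal.ofReal_toReal he).ge
    have h2 : ENNReal.ofReal C * e = ENNReal.ofReal (C * e.toReal) := by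
      rw [ENNReal.ofReal_mul hC.le, ENNReal.ofReal_toReal he]
    rw [h2, ENNReal.log_ofReal_of_pos (by positivity), ← EReal.coe_mul]
    exact h1

theorem theorem1p3 (d : ℕ) (hd : 1 ≤ d) (p s α α₁ α₂ : ℝ) (hp : 1 < p)
    (hs : s ∈ Set.Ioo (0 : ℝ) 1) (hα : α = α₁ + α₂)
    (hα₁ : α₁ * p ∈ Set.Ioo (-(d : ℝ)) (s * p)) (hα₂ : α₂ * p ∈ Set.Ioo (-(d : ℝ)) (s * p))
    (hα0 : 0 ≤ α * p) (hαs : α * p < s * p) (hsub : s * p - α * p < (d : ℝ)) :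
    ∃ C : ℝ, 0 < C ∧
      ∀ u : EuclideanSpace ℝ (Fin d) → ℝ, MemWeightedSobolev s p α₁ α₂ u →
        ∫ x, |u x| ^ p = 1 →
        ∫⁻ x, ENNReal.ofReal (|u x| ^ p * Real.log |u x|) < ⊤ ∧
        extendedIntegral (fun x => |u x| ^ p * Real.log |u x|) ≤
          (((d : ℝ) / ((s - α) * p ^ 2) : ℝ) : EReal) *
            ENNReal.log (ENNReal.ofReal C * gagliardoEnergy s p α₁ α₂ u) := by
  have : NeZero d := ⟨by omega⟩
  have hd' : (0 : ℝ) < d := Nat.cast_pos.mpr hd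
  have hp0 : 0 < p := by linarith
  have hsum : α₁ * p + α₂ * p = α * p := by rw [hα]; ring
  have hβ : 0 ≤ (α₁ * p + α₂ * p) / 2 := by rw [hsum]; positivity
  have hβs : α₁ * p + α₂ * p < s * p := by rwa [hsum]
  have hsα : 0 < s - α := sub_pos.2 (lt_of_mul_lt_mul_right hαs hp0.le)
  obtain ⟨D, hD, hlog⟩ := exists_lintegral_posLog_le_energy (d := d) hp0 hs.1.le hβ hβs one_pos
  set κ : ℝ := d / ((s - α) * p ^ 2) with hκ
  have hκpos : 0 < κ := by positivity
  -- Absorbs the additive constant: κ log(e^(D/κ) E) = κ log E + D.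
  refine ⟨Real.exp (D / κ), Real.exp_pos _, fun u hu h1 => ?_⟩
  have hfin := hu.lintegral_ofReal_rpow_mul_log_lt_top hp0 hs.1.le hβ hβs
  have hm : AEMeasurable u := hu.1.1.aemeasurable
  have hint : Integrable fun x => |u x| ^ p := .of_integral_ne_zero (by rw [h1]; exact one_ne_zero)
  have hN : ∫⁻ x, ENNReal.ofReal (|u x| ^ p) ≤ ENNReal.ofReal 1 := by
    rw [← ofReal_integral_eq_lintegral_ofReal hint
      (Filter.Eventually.of_forall fun x => by positivity), h1]
  refine ⟨hfin, le_mul_log_of_forall_le hκpos (Real.exp_pos _) fun E hE hEu => ?_⟩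
  -- L = E^κ makes the powers of E cancel, as κ(ρ - p) = d/(d+β).
  have h2 := hlog u hm hN E hE hEu (E ^ κ) (by positivity)
  have e1 : E ^ ((d : ℝ) / (d + (α₁ * p + α₂ * p) / 2)) * (E ^ κ) ^ (p - p * (d + s * p -
      (α₁ * p + α₂ * p) / 2) / (d + (α₁ * p + α₂ * p) / 2)) = 1 := by
    rw [← Real.rpow_mul hE.le, ← Real.rpow_add hE, ← Real.rpow_zero E]
    congr 1
    rw [hsum] at hβ ⊢
    rw [hκ]
    have : 0 < d + α * p / 2 := by positivity
    field_simp
    ring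
  rw [mul_assoc, e1, mul_one] at h2
  refine (extendedIntegral_le_of_posLog hm hint h1 hfin (by positivity) hD.le h2 hp0).trans
    (le_of_eq ?_)
  rw [Real.log_mul (Real.exp_pos _).ne' hE.ne', Real.log_exp, Real.log_rpow hE]
  congr 1
  field_simp
  ring
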